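/- Let $n\ge 0$ and equip $\mathbb{R}^n$ with the Euclidean inner product and norm. For $f:\mathbb{R}^n\to\mathbb{R}\cup\{+\infty\}$ write $\mathrm{dom}\,f=\{x: f(x)<+\infty\}$, $f^*(p)=\sup_{x\in\mathbb{R}^n}\{\langle p,x\rangle-f(x)\}$, and $\partial f(x)=\{p: f(y)\ge f(x)+\langle p,y-x\rangle\ \forall y\in\mathbb{R}^n\}$. Let $\Gamma_0(\mathbb{R}^n)$ be the set of proper, convex, lower semicontinuous functions $\mathbb{R}^n\to\mathbb{R}\cup\{+\infty\}$. A function $f\in\Gamma_0(\mathbb{R}^n)$ is called 1-coercive if $f(x)/\|x\|\to+\infty$ as $\|x\|\to\infty$, and Legendre if $\mathrm{int}\,\mathrm{dom}\,f\neq\emptyset$, $f$ is differentiable and strictly convex on $\mathrm{int}\,\mathrm{dom}\,f$, $\partial f(x)=\emptyset$ for $x\in\mathrm{dom}\,f\setminus\mathrm{int}\,\mathrm{dom}\,f$, and $\partial f(x)=\{\nabla f(x)\}$ for $x\in\mathrm{int}\,\mathrm{dom}\,f$. For $x,u\in\mathrm{dom}\,f$ with $f$ differentiable at $u$, the Bregman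 distance is $D_f(x,u)=f(x)-f(u)-\langle\nabla f(u),x-u\rangle$. **Proposition.** Let $J,H\in\Gamma_0(\mathbb{R}^n)$, where $J$ is 1-coercive and $H$ is Legendre. Let $t>0$ and let $x\in\mathbb{R}^n$ satisfy $$x\in\left(\mathrm{dom}\,J+t\,\mathrm{int}\,\mathrm{dom}\,H^*\right)\cap\left(t\,\mathrm{dom}\,H^*\right).$$ Then $H^*$ is differentiable on $\mathrm{int}\,\mathrm{dom}\,H^*$ (so that the first problem below is well defined), and each of the two minimization problems $$\min_{v\in\mathrm{int}\,\mathrm{dom}\,H^*}\left\{tD_{H^*}\!\left(\tfrac{x}{t},v\right)+J^*(\nabla H^*(v))\right\},\qquad \min_{v\in\mathbb{R}^n}\left\{J(x-tv)+tH^*(v)\right\}$$ has exactly one minimizer. The two minimizers coincide: $$\operatorname*{arg\,min}_{v\in\mathrm{int}\,\mathrm{dom}\,H^*}\left\{tD_{H^*}\!\left(\tfrac{x}{t},v\right)+J^*(\nabla H^*(v))\right\}=\operatorname*{arg\,min}_{v\in\mathbb{R}^n}\left\{J(x-tv)+tH^*(v)\right\}.$$ Moreover, the two minimal values are finite and satisfy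 $$\min_{v\in\mathrm{int}\,\mathrm{dom}\,H^*}\left\{tD_{H^*}\!\left(\tfrac{x}{t},v\right)+J^*(\nabla H^*(v))\right\}+\min_{v\in\mathbb{R}^n}\left\{J(x-tv)+tH^*(v)\right\}=(tH)^*(x).$$ -/

import Mathlib

open Set Filter Topology
open scoped Pointwise

noncomputable section

namespace ConvexModel

/-- Extended-valued functions on Euclidean space `ℝⁿ` with the standard inner product and norm. -/
abbrev ExtFun (n : ℕ) : Type := EuclideanSpace ℝ (Fin n) → EReal

variable {n : ℕ}

/-- The effective domain `dom f = {x | f x < +∞}`. -/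
def dom (f : ExtFun n) : Set (EuclideanSpace ℝ (Fin n)) := {x | f x < ⊤}

/-- `Γ₀(ℝⁿ)`: proper, convex, lower semicontinuous functions `ℝⁿ → ℝ ∪ {+∞}`. -/
structure IsGammaZero (f : ExtFun n) : Prop where
  ne_bot : ∀ x, f x ≠ ⊥
  proper : (dom f).Nonempty
  convex : ∀ x y : EuclideanSpace ℝ (Fin n), ∀ a b : ℝ, 0 ≤ a → 0 ≤ b → a + b = 1 →
    f (a • x + b • y) ≤ (a : EReal) * f x + (b : EReal) * f y
  lsc : LowerSemicontinuous f

/-- 1-coercivity: `f x / ‖x‖ → +∞` as `‖x‖ → ∞`. -/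
def IsOneCoercive (f : ExtFun n) : Prop :=
  Tendsto (fun x => f x / ((‖x‖ : ℝ) : EReal)) (Bornology.cobounded (EuclideanSpace ℝ (Fin n)))
    (𝓝 ⊤)

/-- The Legendre-Fenchel transform `f* p = sup_x (⟨p, x⟩ - f x)`. -/
def conj (f : ExtFun n) : ExtFun n :=
  fun p => ⨆ x : EuclideanSpace ℝ (Fin n), ((inner ℝ p x : ℝ) : EReal) - f x

/-- The subdifferential `∂f(x)`. -/
def subdiff (f : ExtFun n) (x : EuclideanSpace ℝ (Fin n)) : Set (EuclideanSpace ℝ (Fin n)) :=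
  {p | ∀ y, f x + ((inner ℝ p (y - x) : ℝ) : EReal) ≤ f y}

/-- Differentiability of an extended-valued function at a point of the interior of its domain
(near such a point a function without the value `-∞` agrees with its real part). -/
def DiffAt (f : ExtFun n) (x : EuclideanSpace ℝ (Fin n)) : Prop :=
  DifferentiableAt ℝ (fun y => (f y).toReal) x

/-- The gradient `∇f(x)`, for `x` in the interior of the domain. -/
def grad (f : ExtFun n) (x : EuclideanSpace ℝ (Fin n)) : EuclideanSpace ℝ (Fin n) :=
  gradient (fun y => (f y).toReal) x

/-- Convex functions of Legendre type. -/
structure IsLegendre (f : ExtFun n) : Prop where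
  gammaZero : IsGammaZero f
  nonempty_interior : (interior (dom f)).Nonempty
  diffAt : ∀ x ∈ interior (dom f), DiffAt f x
  subdiff_boundary : ∀ x ∈ dom f \ interior (dom f), subdiff f x = ∅
  subdiff_interior : ∀ x ∈ interior (dom f), subdiff f x = {grad f x}
  strictConvex : StrictConvexOn ℝ (interior (dom f)) (fun x => (f x).toReal)

/-- The Bregman distance `D_f(x, u) = f x - f u - ⟨∇f(u), x - u⟩`. -/
def bregman (f : ExtFun n) (x u : EuclideanSpace ℝ (Fin n)) : EReal :=
  f x - f u - ((inner ℝ (grad f u) (x - u) : ℝ) : EReal)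

/-- The set of minimizers of `F` over `S`. -/
def argmin (S : Set (EuclideanSpace ℝ (Fin n))) (F : ExtFun n) :
    Set (EuclideanSpace ℝ (Fin n)) :=
  {v | v ∈ S ∧ ∀ w ∈ S, F v ≤ F w}

/-- The objective `v ↦ t D_{H*}(x / t, v) + J*(∇H*(v))`, to be minimized over `int dom H*`. -/
def nonadditive (J H : ExtFun n) (t : ℝ) (x : EuclideanSpace ℝ (Fin n)) : ExtFun n :=
  fun v => (t : EReal) * bregman (conj H) (t⁻¹ • x) v + conj J (grad (conj H) v)

/-- The objective `v ↦ J(x - t v) + t H*(v)`, to be minimized over `ℝⁿ`. -/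
def additive (J H : ExtFun n) (t : ℝ) (x : EuclideanSpace ℝ (Fin n)) : ExtFun n :=
  fun v => J (x - t • v) + (t : EReal) * conj H v

end ConvexModel

end

/-!
The two problems are tied together by Fenchel duality. Put `q = ∇H*(v)`, so that
`H*(v) = ⟨v, q⟩ - H(q)`. Then the first objective is

  `t H*(x/t) + (J*(q) + t H(q) - ⟨q, x⟩)`,

and the bracket is the objective of the Fenchel dual, up to sign, of the second problem.
Everything follows from a single pair `(p, v)` with `p ∈ ∂J(x - t v)` and `v ∈ ∂H(p)`: the
Fenchel–Young inequalities for `J` and for `H` show that the second objective plus the bracket is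
nonnegative, and vanishes only when both inequalities are equalities. Since `H` is Legendre, its
subdifferential is single-valued, so an equality `w ∈ ∂H(p)` or `v ∈ ∂H(q)` identifies the point.
Hence `v` is the only minimizer of either problem, and the minimal values add up to
`t H*(x/t) = (t H)*(x)`.

The pair is found from the dual side (`exists_primal_dual`). The function `J*` is finite because
`J` is 1-coercive, and `x ∈ dom J + t int dom H*` makes `J* + t H - ⟨·, x⟩` coercive, so it has a
minimizer `p` (`exists_dual_minimizer`). Its optimality in each direction provides, by Danskin's
argument, a point `z` of the compact convex set `{z | p ∈ ∂J(z)}` depending on the direction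
(`exists_subgradient_of_dual_minimizer`); Sion's minimax theorem makes `z` independent of it, and
`v = (x - z) / t`.

The part of the Legendre duality between `H` and `H*` that is needed rests on `HasGrowth`, a
linear growth condition characterizing `int dom H*`: under it maximizers in the definition of
`H*` exist and vary semicontinuously (`HasGrowth.exists_tendsto_subseq`), which, with uniqueness of
the maximizer, gives differentiability (`hasGradientAt_conj`). Conversely a unique maximizer forces
the growth (`IsGammaZero.hasGrowth_of_unique`), whence `∂H` takes values in `int dom H*`.

Extended-valued functions are handled through inequalities `f y ≤ r` with real `r`, that is,
through their epigraphs.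
-/

namespace ConvexModel

/-! ### Subgradients, conjugates and growth -/

section Subgradients
variable {n : ℕ} {f : ExtFun n} {v p q : EuclideanSpace ℝ (Fin n)}

theorem exists_real_of_mem_dom (hb : ∀ y, f y ≠ ⊥) (hq : q ∈ dom f) : ∃ a : ℝ, f q = a :=
  ⟨(f q).toReal, (EReal.coe_toReal (ne_of_lt hq) (hb q)).symm⟩

theorem exists_real_of_le {r : ℝ} (hb : ∀ y, f y ≠ ⊥) (hq : f q ≤ r) :
    ∃ a : ℝ, f q = a ∧ a ≤ r := by
  obtain ⟨a, ha⟩ := exists_real_of_mem_dom hb (lt_of_le_of_lt hq (EReal.coe_lt_top r))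
  exact ⟨a, ha, by rw [ha] at hq; exact_mod_cast hq⟩

theorem conj_le_iff (hb : ∀ y, f y ≠ ⊥) {c : ℝ} :
    conj f v ≤ c ↔ ∀ (y : EuclideanSpace ℝ (Fin n)) (r : ℝ), f y ≤ r → inner ℝ v y - r ≤ c := by
  rw [conj, iSup_le_iff]
  constructor
  · intro h y r hr
    obtain ⟨a, ha, har⟩ := exists_real_of_le hb hr
    have := h y
    rw [ha, ← EReal.coe_sub, EReal.coe_le_coe_iff] at this
    linarith
  · intro h y
    by_cases hy : y ∈ dom f
    · obtain ⟨a, ha⟩ := exists_real_of_mem_dom hb hy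
      rw [ha, ← EReal.coe_sub, EReal.coe_le_coe_iff]
      exact h y a ha.le
    · have : f y = ⊤ := by simpa [dom] using hy
      simp [this]

theorem mem_subdiff_iff (hb : ∀ y, f y ≠ ⊥) {a : ℝ} (hq : f q = a) :
    v ∈ subdiff f q ↔
      ∀ (y : EuclideanSpace ℝ (Fin n)) (r : ℝ), f y ≤ r → a + inner ℝ v (y - q) ≤ r := by
  constructor
  · intro h y r hr
    have := (h y).trans hr
    rw [hq] at this
    exact_mod_cast this
  · intro h y
    rw [hq]
    by_cases hy : y ∈ dom f
    · obtain ⟨b, hb⟩ := exists_real_of_mem_dom hb hy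
      have := h y b hb.le
      rw [hb]
      exact_mod_cast this
    · have : f y = ⊤ := by simpa [dom] using hy
      simp [this]

theorem exists_real_of_mem_subdiff (hb : ∀ y, f y ≠ ⊥) (hp : (dom f).Nonempty)
    (h : v ∈ subdiff f q) : ∃ a : ℝ, f q = a := by
  refine exists_real_of_mem_dom hb (show f q < ⊤ from lt_top_iff_ne_top.2 fun hq => ?_)
  obtain ⟨y, hy⟩ := hp
  have := h y
  rw [hq, EReal.top_add_coe] at this
  exact (ne_of_lt hy) (top_le_iff.1 this)

theorem coe_sub_le_conj {a : ℝ} (hq : f q = a) : ((inner ℝ v q - a : ℝ) : EReal) ≤ conj f v := by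
  have : ((inner ℝ v q : ℝ) : EReal) - f q ≤ conj f v :=
    le_iSup (fun x : EuclideanSpace ℝ (Fin n) => ((inner ℝ v x : ℝ) : EReal) - f x) q
  rw [hq] at this
  exact_mod_cast this

theorem conj_ne_bot (hb : ∀ y, f y ≠ ⊥) (hp : (dom f).Nonempty) : conj f v ≠ ⊥ := by
  obtain ⟨y, hy⟩ := hp
  obtain ⟨a, ha⟩ := exists_real_of_mem_dom hb hy
  intro h
  have := coe_sub_le_conj (v := v) ha
  rw [h] at this
  exact EReal.coe_ne_bot _ (le_bot_iff.1 this)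

/-- Equality in the Fenchel–Young inequality characterizes subgradients. -/
theorem mem_subdiff_iff_conj_eq (hb : ∀ y, f y ≠ ⊥) {a : ℝ} (hq : f q = a) :
    v ∈ subdiff f q ↔ conj f v = ((inner ℝ v q - a : ℝ) : EReal) := by
  rw [mem_subdiff_iff hb hq]
  constructor
  · intro h
    refine le_antisymm ((conj_le_iff hb).2 fun y r hr => ?_) (coe_sub_le_conj hq)
    have := h y r hr
    rw [inner_sub_right] at this
    linarith
  · intro h y r hr
    have := (conj_le_iff hb).1 h.le y r hr
    rw [inner_sub_right]
    linarith

theorem isClosed_epigraph (hf : LowerSemicontinuous f) :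
    IsClosed {z : EuclideanSpace ℝ (Fin n) × ℝ | f z.1 ≤ z.2} := by
  have h := hf.isClosed_epigraph
  exact h.preimage (continuous_fst.prodMk (continuous_coe_real_ereal.comp continuous_snd))

theorem isClosed_epigraph_conj (hb : ∀ y, f y ≠ ⊥) :
    IsClosed {z : EuclideanSpace ℝ (Fin n) × ℝ | conj f z.1 ≤ z.2} := by
  simp only [conj_le_iff hb, ofPred_forall]
  refine isClosed_iInter fun y => isClosed_iInter fun r => isClosed_iInter fun _ => ?_
  exact isClosed_le (by fun_prop) (by fun_prop)

theorem IsGammaZero.le_combo (hf : IsGammaZero f) {y z : EuclideanSpace ℝ (Fin n)}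
    {r s a b : ℝ} (hy : f y ≤ r) (hz : f z ≤ s) (ha : 0 ≤ a) (hb : 0 ≤ b) (hab : a + b = 1) :
    f (a • y + b • z) ≤ ((a * r + b * s : ℝ) : EReal) := by
  refine (hf.convex y z a b ha hb hab).trans ?_
  rw [EReal.coe_add, EReal.coe_mul, EReal.coe_mul]
  exact add_le_add (mul_le_mul_of_nonneg_left hy (by exact_mod_cast ha))
    (mul_le_mul_of_nonneg_left hz (by exact_mod_cast hb))

/-- `f` exceeds the linear function `⟨v, ·⟩` by a positive multiple of the norm, up to a
constant. When `f` omits the value `-∞` this is equivalent to `v ∈ int dom f*`. -/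
def HasGrowth (f : ExtFun n) (v : EuclideanSpace ℝ (Fin n)) : Prop :=
  ∃ ε > 0, ∃ C : ℝ, ∀ (y : EuclideanSpace ℝ (Fin n)) (r : ℝ), f y ≤ r →
    inner ℝ v y + ε * ‖y‖ - C ≤ r

theorem exists_isMinOn_of_isBounded_sublevel {F : Type*} [PseudoMetricSpace F] [ProperSpace F]
    {K : Set F} (hK : IsClosed K) {g : F → ℝ} (hg : Continuous g) {k : F} (hk : k ∈ K)
    (hb : Bornology.IsBounded (K ∩ {z | g z ≤ g k})) : ∃ m ∈ K, ∀ z ∈ K, g m ≤ g z := by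
  have hc : IsCompact (K ∩ {z | g z ≤ g k}) :=
    Metric.isCompact_of_isClosed_isBounded (hK.inter (isClosed_le hg continuous_const)) hb
  obtain ⟨m, hm, hmin⟩ := hc.exists_isMinOn ⟨k, hk, le_refl (g k)⟩ hg.continuousOn
  refine ⟨m, hm.1, fun z hz => ?_⟩
  rcases le_total (g z) (g k) with h | h
  · exact hmin ⟨hz, h⟩
  · exact hm.2.trans h

/-- Under the growth condition the supremum defining the conjugate is attained. -/
theorem HasGrowth.exists_mem_subdiff (hg : HasGrowth f v) (hb : ∀ y, f y ≠ ⊥)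
    (hp : (dom f).Nonempty) (hl : LowerSemicontinuous f) : ∃ q, v ∈ subdiff f q := by
  obtain ⟨ε, hε, C, hC⟩ := hg
  obtain ⟨y₀, hy₀⟩ := hp
  obtain ⟨r₀, hr₀⟩ := exists_real_of_mem_dom hb hy₀
  obtain ⟨⟨q, a⟩, hqa, hmin⟩ := exists_isMinOn_of_isBounded_sublevel (isClosed_epigraph hl)
    (g := fun z => z.2 - inner ℝ v z.1) (by fun_prop) (k := (y₀, r₀)) hr₀.le (by
      set c := r₀ - inner ℝ v y₀
      set R := (C + c) / ε
      refine (Metric.isBounded_closedBall (x := (0 : EuclideanSpace ℝ (Fin n) × ℝ))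
        (r := |R| + (|c| + ‖v‖ * |R| + |C|))).subset ?_
      rintro ⟨y, r⟩ ⟨h1, h2⟩
      simp only [mem_ofPred_eq] at h1 h2
      have h3 := hC y r h1
      have hy : ‖y‖ ≤ R := by rw [le_div_iff₀ hε]; linarith
      have hyR := hy.trans (le_abs_self R)
      have h4 : |inner ℝ v y| ≤ ‖v‖ * |R| :=
        (abs_real_inner_le_norm v y).trans (by gcongr)
      have h5 := abs_le.1 h4
      have h6 : 0 ≤ ε * ‖y‖ := by positivity
      have h7 := le_abs_self c
      have h8 := le_abs_self C
      have h9 := abs_nonneg R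
      have h10 := abs_nonneg c
      have h11 := abs_nonneg C
      have h12 : 0 ≤ ‖v‖ * |R| := by positivity
      rw [mem_closedBall_zero_iff, Prod.norm_def, max_le_iff, Real.norm_eq_abs, abs_le]
      refine ⟨by linarith, by linarith, ?_⟩
      change r - inner ℝ v y ≤ c at h2
      linarith)
  obtain ⟨b, hqb, hba⟩ := exists_real_of_le hb (hqa : f q ≤ (a : EReal))
  refine ⟨q, (mem_subdiff_iff hb hqb).2 fun y r hr => ?_⟩
  have := hmin (y, r) hr
  simp only at this
  rw [inner_sub_right]
  linarith

/-- Points carrying subgradients `wₖ → v` stay bounded when `f` grows at `v`, and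
by closedness of the epigraph any limit carries the subgradient `v`. -/
theorem HasGrowth.exists_tendsto_subseq (hg : HasGrowth f v) (hb : ∀ y, f y ≠ ⊥)
    (hp : (dom f).Nonempty) (hl : LowerSemicontinuous f)
    {w u : ℕ → EuclideanSpace ℝ (Fin n)} (hw : Tendsto w atTop (𝓝 v))
    (hu : ∀ k, w k ∈ subdiff f (u k)) :
    ∃ q, v ∈ subdiff f q ∧ ∃ φ : ℕ → ℕ, StrictMono φ ∧ Tendsto (u ∘ φ) atTop (𝓝 q) := by
  obtain ⟨ε, hε, C, hC⟩ := hg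
  choose a ha using fun k => exists_real_of_mem_subdiff hb hp (hu k)
  have hsub : ∀ k y (r : ℝ), f y ≤ r → a k + inner ℝ (w k) (y - u k) ≤ r :=
    fun k => (mem_subdiff_iff hb (ha k)).1 (hu k)
  obtain ⟨y₀, hy₀⟩ := hp
  obtain ⟨r₀, hr₀⟩ := exists_real_of_mem_dom hb hy₀
  set W := ‖v‖ + ε / 2
  set R := 2 * (C + r₀ + W * ‖y₀‖) / ε
  have hbd : ∀ᶠ k in atTop, (u k, a k) ∈ Metric.closedBall
      (0 : EuclideanSpace ℝ (Fin n) × ℝ) (|R| + (|C| + |r₀| + W * ‖y₀‖ + W * |R|)) := by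
    filter_upwards [hw (Metric.closedBall_mem_nhds v (half_pos hε))] with k hk
    rw [mem_preimage, mem_closedBall_iff_norm] at hk
    have hW : 0 ≤ W := by positivity
    have hwW : ‖w k‖ ≤ W := by
      have : w k = v + (w k - v) := by abel
      rw [this]
      exact (norm_add_le _ _).trans (add_le_add_right hk _)
    have h1 := hsub k y₀ r₀ hr₀.le
    have h2 := hC (u k) (a k) (ha k).le
    rw [inner_sub_right] at h1
    have h3 : |inner ℝ (w k) y₀| ≤ W * ‖y₀‖ :=
      (abs_real_inner_le_norm _ _).trans (by gcongr)
    have h4 : inner ℝ (w k) (u k) - inner ℝ v (u k) ≤ ε / 2 * ‖u k‖ := by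
      rw [← inner_sub_left]
      exact (real_inner_le_norm _ _).trans (by gcongr)
    have h5 := abs_le.1 h3
    have hR : ‖u k‖ ≤ R := by
      rw [le_div_iff₀ hε]
      linarith
    have hR' := hR.trans (le_abs_self R)
    have h6 : |inner ℝ (w k) (u k)| ≤ W * |R| :=
      (abs_real_inner_le_norm _ _).trans (by gcongr)
    have h7 : |inner ℝ v (u k)| ≤ W * |R| :=
      (abs_real_inner_le_norm _ _).trans
        (mul_le_mul (le_add_of_nonneg_right (by positivity)) hR' (norm_nonneg _) hW)
    have h6' := abs_le.1 h6
    have h7' := abs_le.1 h7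
    have h8 : 0 ≤ W * |R| := by positivity
    have h9 : 0 ≤ W * ‖y₀‖ := by positivity
    have h10 : 0 ≤ ε * ‖u k‖ := by positivity
    have := le_abs_self C
    have := le_abs_self r₀
    have := abs_nonneg C
    have := abs_nonneg r₀
    have := abs_nonneg R
    rw [mem_closedBall_zero_iff, Prod.norm_def, max_le_iff, Real.norm_eq_abs, abs_le]
    exact ⟨by linarith, by linarith, by linarith⟩
  obtain ⟨⟨q, b⟩, -, φ, hφ, hlim⟩ :=
    tendsto_subseq_of_frequently_bounded Metric.isBounded_closedBall hbd.frequently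
  have hq : Tendsto (fun k => u (φ k)) atTop (𝓝 q) := (continuous_fst.tendsto _).comp hlim
  have hab : Tendsto (fun k => a (φ k)) atTop (𝓝 b) := (continuous_snd.tendsto _).comp hlim
  have hqb : f q ≤ b := (isClosed_epigraph hl).mem_of_tendsto hlim
    (Eventually.of_forall fun k => (ha (φ k)).le)
  obtain ⟨c, hqc, hcb⟩ := exists_real_of_le hb hqb
  refine ⟨q, (mem_subdiff_iff hb hqc).2 fun y r hr => ?_, φ, hφ, hq⟩
  have hlim2 : Tendsto (fun k => a (φ k) + inner ℝ (w (φ k)) (y - u (φ k))) atTop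
      (𝓝 (b + inner ℝ v (y - q))) :=
    hab.add ((hw.comp hφ.tendsto_atTop).inner (tendsto_const_nhds.sub hq))
  have := le_of_tendsto hlim2 (Eventually.of_forall fun k => hsub (φ k) y r hr)
  linarith

end Subgradients

/-! ### The interior of the domain of the conjugate -/

section Growth
variable {n : ℕ} {f : ExtFun n} {v p q : EuclideanSpace ℝ (Fin n)}

theorem IsOneCoercive.hasGrowth (hc : IsOneCoercive f) (hb : ∀ y, f y ≠ ⊥)
    (hl : LowerSemicontinuous f) (v : EuclideanSpace ℝ (Fin n)) : HasGrowth f v := by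
  have h1 := hc.eventually (lt_mem_nhds (EReal.coe_lt_top (‖v‖ + 1)))
  rw [← comap_norm_atTop, eventually_comap] at h1
  obtain ⟨R, hR⟩ := eventually_atTop.1 h1
  obtain ⟨m, -, hm⟩ := LowerSemicontinuousOn.exists_isMinOn
    (s := Metric.closedBall (0 : EuclideanSpace ℝ (Fin n)) |R|)
    ⟨0, by simp⟩ (isCompact_closedBall _ _) (hl.lowerSemicontinuousOn _)
  refine ⟨1, one_pos, (‖v‖ + 1) * |R| + |(f m).toReal|, fun y r hr => ?_⟩
  have hvy : inner ℝ v y + 1 * ‖y‖ ≤ (‖v‖ + 1) * ‖y‖ := by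
    have := real_inner_le_norm v y
    linarith
  obtain ⟨a, ha, har⟩ := exists_real_of_le hb hr
  have h0 := abs_nonneg (f m).toReal
  have h0' : 0 ≤ (‖v‖ + 1) * |R| := by positivity
  rcases le_or_gt ‖y‖ |R| with hy | hy
  · have hmy : f m ≤ a := ha ▸ hm (mem_closedBall_zero_iff.2 hy)
    obtain ⟨b, hmb, hba⟩ := exists_real_of_le hb hmy
    have h2 : (‖v‖ + 1) * ‖y‖ ≤ (‖v‖ + 1) * |R| := by gcongr
    have h3 : (f m).toReal = b := by rw [hmb, EReal.toReal_coe]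
    have h4 := neg_abs_le (f m).toReal
    linarith
  · have hpos : 0 < ‖y‖ := (abs_nonneg R).trans_lt hy
    have h2 := hR ‖y‖ ((le_abs_self R).trans hy.le) y rfl
    rw [ha, ← EReal.coe_div, EReal.coe_lt_coe_iff, lt_div_iff₀ hpos] at h2
    linarith

/-- The domain of the conjugate contains a cross-polytope around `v`, and each coordinate of `y`
is controlled by the two vertices on its axis. -/
theorem hasGrowth_of_mem_interior (hb : ∀ y, f y ≠ ⊥) (hv : v ∈ interior (dom (conj f))) :
    HasGrowth f v := by
  obtain ⟨δ, hδ, hball⟩ := Metric.nhds_basis_closedBall.mem_iff.1 (mem_interior_iff_mem_nhds.1 hv)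
  have hval : ∀ w ∈ Metric.closedBall v δ, ∃ c : ℝ, conj f w ≤ c := fun w hw =>
    ⟨(conj f w).toReal, EReal.le_coe_toReal (ne_of_lt (hball hw))⟩
  obtain ⟨c₀, hc₀⟩ := hval v (Metric.mem_closedBall_self hδ.le)
  have hplus : ∀ i, ∃ c : ℝ, conj f (v + δ • EuclideanSpace.single i 1) ≤ c := fun i =>
    hval _ (by simp [norm_smul, abs_of_pos hδ])
  have hminus : ∀ i, ∃ c : ℝ, conj f (v + (-δ) • EuclideanSpace.single i 1) ≤ c := fun i =>
    hval _ (by simp [norm_smul, abs_of_pos hδ])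
  choose c hc using hplus
  choose d hd using hminus
  have hn : (0 : ℝ) < n + 1 := by positivity
  refine ⟨δ / (n + 1), by positivity, (|c₀| + ∑ i, (|c i| + |d i|)), fun y r hr => ?_⟩
  have h0 := (conj_le_iff hb).1 hc₀ y r hr
  have hi : ∀ i, inner ℝ v y + δ * |y i| - (|c i| + |d i|) ≤ r := fun i => by
    have h1 := (conj_le_iff hb).1 (hc i) y r hr
    have h2 := (conj_le_iff hb).1 (hd i) y r hr
    rw [inner_add_left, real_inner_smul_left, EuclideanSpace.inner_single_left] at h1 h2
    simp only [map_one, one_mul] at h1 h2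
    have := le_abs_self (c i)
    have := le_abs_self (d i)
    have := abs_nonneg (c i)
    have := abs_nonneg (d i)
    rcases abs_cases (y i) with ⟨h, -⟩ | ⟨h, -⟩ <;> rw [h] <;> linarith
  have hnorm : ‖y‖ ≤ ∑ i, |y i| := by
    have hy : y = ∑ i, y i • EuclideanSpace.single i (1 : ℝ) := by
      ext j
      simp [Finset.sum_apply, Pi.single_apply]
    calc ‖y‖ = ‖∑ i, y i • EuclideanSpace.single i (1 : ℝ)‖ := by rw [← hy]
      _ ≤ ∑ i, ‖y i • EuclideanSpace.single i (1 : ℝ)‖ := norm_sum_le _ _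
      _ = ∑ i, |y i| := by simp [norm_smul]
  have hsum := Finset.sum_le_sum fun i (_ : i ∈ Finset.univ) => hi i
  simp only [Finset.sum_add_distrib, Finset.sum_sub_distrib, Finset.sum_const,
    Finset.card_univ, Fintype.card_fin, nsmul_eq_mul, ← Finset.mul_sum] at hsum
  have h3 : δ * ‖y‖ ≤ δ * ∑ i, |y i| := by gcongr
  set S := |c₀| + ∑ i, (|c i| + |d i|)
  have hS : 0 ≤ S := by positivity
  have hSe : S = |c₀| + (∑ i, |c i| + ∑ i, |d i|) := by rw [← Finset.sum_add_distrib]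
  have h4 := le_abs_self c₀
  have h5 : (n + 1 : ℝ) * (inner ℝ v y + δ / (n + 1) * ‖y‖ - S) ≤ (n + 1) * r := by
    have h6 : (n + 1 : ℝ) * (δ / (n + 1) * ‖y‖) = δ * ‖y‖ := by field_simp
    have h7 : 0 ≤ (n : ℝ) * S := by positivity
    nlinarith
  exact le_of_mul_le_mul_left h5 hn

theorem HasGrowth.mem_interior (hg : HasGrowth f v) (hb : ∀ y, f y ≠ ⊥) :
    v ∈ interior (dom (conj f)) := by
  obtain ⟨ε, hε, C, hC⟩ := hg
  refine mem_interior_iff_mem_nhds.2 (mem_of_superset (Metric.closedBall_mem_nhds v hε) ?_)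
  intro w hw
  rw [mem_closedBall_iff_norm] at hw
  refine lt_of_le_of_lt ((conj_le_iff hb).2 fun y r hr => ?_) (EReal.coe_lt_top C)
  have h1 := hC y r hr
  have h2 : inner ℝ w y - inner ℝ v y ≤ ε * ‖y‖ := by
    rw [← inner_sub_left]
    exact (real_inner_le_norm _ _).trans (by gcongr)
  linarith

/-- If `f - ⟨v, ·⟩` has a unique minimizer `p`, it exceeds its minimum by a fixed amount on the
unit sphere around `p`, hence, by convexity, grows linearly away from `p`. -/
theorem IsGammaZero.hasGrowth_of_unique (hf : IsGammaZero f) (hvp : v ∈ subdiff f p)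
    (huniq : ∀ q, v ∈ subdiff f q → q = p) : HasGrowth f v := by
  obtain ⟨a, ha⟩ := exists_real_of_mem_subdiff hf.ne_bot hf.proper hvp
  have hsub := (mem_subdiff_iff hf.ne_bot ha).1 hvp
  obtain ⟨η, hη, hsph⟩ : ∃ η > 0, ∀ (y : EuclideanSpace ℝ (Fin n)) (r : ℝ), ‖y - p‖ = 1 →
      f y ≤ r → a + inner ℝ v (y - p) + η ≤ r := by
    by_contra! hcon
    choose y r hy hyr hlt using fun k : ℕ => hcon (1 / ((k : ℝ) + 1)) Nat.one_div_pos_of_nat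
    obtain ⟨z, hz, φ, hφ, hlim⟩ := (isCompact_sphere p (1 : ℝ)).tendsto_subseq
      (fun k => mem_sphere_iff_norm.2 (hy k))
    have hone := (tendsto_one_div_add_atTop_nhds_zero_nat (𝕜 := ℝ)).comp hφ.tendsto_atTop
    have hlim2 : Tendsto (fun k => a + inner ℝ v (y (φ k) - p) + 1 / ((φ k : ℝ) + 1)) atTop
        (𝓝 (a + inner ℝ v (z - p) + 0)) :=
      ((tendsto_const_nhds.inner (hlim.sub tendsto_const_nhds)).const_add a).add hone
    have hle : f z ≤ ((a + inner ℝ v (z - p) + 0 : ℝ) : EReal) :=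
      (isClosed_epigraph hf.lsc).mem_of_tendsto (hlim.prodMk_nhds hlim2)
        (Eventually.of_forall fun k => (hyr (φ k)).trans (by exact_mod_cast (hlt (φ k)).le))
    obtain ⟨b, hzb, hb⟩ := exists_real_of_le hf.ne_bot hle
    have hzp : z = p := huniq z ((mem_subdiff_iff hf.ne_bot hzb).2 fun x s hs => by
      have h1 := hsub x s hs
      have h2 : inner ℝ v (x - p) = inner ℝ v (x - z) + inner ℝ v (z - p) := by
        rw [← inner_add_right]; congr 1; abel
      linarith)
    rw [hzp] at hz
    simp at hz
  refine ⟨η, hη, inner ℝ v p + η * ‖p‖ + η - a, fun y r hr => ?_⟩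
  have htri : ‖y‖ ≤ ‖y - p‖ + ‖p‖ := by simpa using norm_add_le (y - p) p
  have htri' : η * ‖y‖ ≤ η * ‖y - p‖ + η * ‖p‖ := by rw [← mul_add]; gcongr
  have hlin : inner ℝ v (y - p) = inner ℝ v y - inner ℝ v p := inner_sub_right _ _ _
  rcases lt_or_ge ‖y - p‖ 1 with h | h
  · have h1 := hsub y r hr
    have h2 : η * ‖y - p‖ ≤ η * 1 := by gcongr
    linarith
  · have hpos : 0 < ‖y - p‖ := one_pos.trans_le h
    set s := ‖y - p‖⁻¹
    have hs : 0 < s := inv_pos.2 hpos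
    have hs1 : s ≤ 1 := inv_le_one_of_one_le₀ h
    have hc := hf.le_combo ha.le hr (sub_nonneg.2 hs1) hs.le (by ring)
    have hpt : (1 - s) • p + s • y - p = s • (y - p) := by module
    have h1 := hsph _ _ (by
      rw [hpt, norm_smul, Real.norm_of_nonneg hs.le, inv_mul_cancel₀ hpos.ne']) hc
    rw [hpt, inner_smul_right] at h1
    have h2 : s * (a + inner ℝ v (y - p) + η * ‖y - p‖) ≤ s * r := by
      have : s * (η * ‖y - p‖) = η := by
        rw [mul_left_comm, inv_mul_cancel₀ hpos.ne', mul_one]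
      linarith
    have h3 := le_of_mul_le_mul_left h2 hs
    linarith

/-- The conjugate is differentiable where the supremum defining it has a single maximizer `q`:
maximizers at nearby points converge to `q` and squeeze the difference quotients. -/
theorem hasGradientAt_conj (hb : ∀ y, f y ≠ ⊥) (hp : (dom f).Nonempty)
    (hl : LowerSemicontinuous f) (hv : v ∈ interior (dom (conj f))) (hvq : v ∈ subdiff f q)
    (huniq : ∀ u, v ∈ subdiff f u → u = q) :
    HasGradientAt (fun w => (conj f w).toReal) q v := by
  obtain ⟨a, ha⟩ := exists_real_of_mem_subdiff hb hp hvq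
  have hcv := (mem_subdiff_iff_conj_eq hb ha).1 hvq
  have hclose : ∀ c > 0, ∀ᶠ w in 𝓝 v, ∀ u, w ∈ subdiff f u → ‖u - q‖ ≤ c := by
    intro c hc
    by_contra hcon
    obtain ⟨w, hw, hwc⟩ := exists_seq_forall_of_frequently (not_eventually.1 hcon)
    push Not at hwc
    choose u hu huc using hwc
    obtain ⟨q', hq', φ, -, hlim⟩ :=
      (hasGrowth_of_mem_interior hb hv).exists_tendsto_subseq hb hp hl hw hu
    rw [huniq q' hq'] at hlim
    have := ge_of_tendsto (hlim.sub_const q).norm (Eventually.of_forall fun k => (huc (φ k)).le)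
    simp only [sub_self, norm_zero] at this
    linarith
  rw [hasGradientAt_iff_isLittleO, Asymptotics.isLittleO_iff]
  intro c hc
  filter_upwards [hclose c hc, isOpen_interior.mem_nhds hv] with w hw hwi
  obtain ⟨u, hu⟩ := (hasGrowth_of_mem_interior hb hwi).exists_mem_subdiff hb hp hl
  obtain ⟨b, hub⟩ := exists_real_of_mem_subdiff hb hp hu
  have hcw := (mem_subdiff_iff_conj_eq hb hub).1 hu
  have h1 := (mem_subdiff_iff hb ha).1 hvq u b hub.le
  have h2 := (mem_subdiff_iff hb hub).1 hu q a ha.le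
  have h3 : inner ℝ (u - q) (w - v) ≤ c * ‖w - v‖ :=
    (real_inner_le_norm _ _).trans (by gcongr; exact hw u hu)
  rw [hcw, hcv, EReal.toReal_coe, EReal.toReal_coe, Real.norm_eq_abs, abs_le]
  simp only [inner_sub_left, inner_sub_right] at h1 h2 h3 ⊢
  rw [real_inner_comm w u, real_inner_comm v u, real_inner_comm w q, real_inner_comm v q] at *
  constructor <;> nlinarith [norm_nonneg (w - v)]

end Growth

/-! ### Legendre functions -/

section Legendre
variable {n : ℕ} {H : ExtFun n} {v p q : EuclideanSpace ℝ (Fin n)}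

theorem IsLegendre.mem_interior_of_mem_subdiff (hH : IsLegendre H) (h : v ∈ subdiff H q) :
    q ∈ interior (dom H) := by
  obtain ⟨a, ha⟩ := exists_real_of_mem_subdiff hH.gammaZero.ne_bot hH.gammaZero.proper h
  by_contra hq
  have hqd : q ∈ dom H := by simp [dom, ha]
  have h2 := hH.subdiff_boundary q ⟨hqd, hq⟩
  rw [h2] at h
  exact h

theorem IsLegendre.eq_grad_of_mem_subdiff (hH : IsLegendre H) (h : v ∈ subdiff H q) :
    v = grad H q := by
  have := hH.subdiff_interior q (hH.mem_interior_of_mem_subdiff h)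
  rw [this] at h
  exact h

theorem IsLegendre.eq_of_mem_subdiff (hH : IsLegendre H) (hp : v ∈ subdiff H p)
    (hq : v ∈ subdiff H q) : q = p := by
  have hb := hH.gammaZero.ne_bot
  obtain ⟨a, ha⟩ := exists_real_of_mem_subdiff hb hH.gammaZero.proper hp
  obtain ⟨b, hqb⟩ := exists_real_of_mem_subdiff hb hH.gammaZero.proper hq
  by_contra hne
  have hpi := hH.mem_interior_of_mem_subdiff hp
  have hqi := hH.mem_interior_of_mem_subdiff hq
  have hlt := hH.strictConvex.2 hqi hpi hne (half_pos one_pos) (half_pos one_pos)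
    (add_halves (1 : ℝ))
  have hmi := hH.strictConvex.1 hqi hpi (half_pos one_pos).le (half_pos one_pos).le
    (add_halves (1 : ℝ))
  obtain ⟨c, hc⟩ := exists_real_of_mem_dom hb (interior_subset hmi)
  have h1 := (mem_subdiff_iff hb ha).1 hp _ c hc.le
  have h2 := (mem_subdiff_iff hb hqb).1 hq _ c hc.le
  simp only [ha, hqb, hc, EReal.toReal_coe, smul_eq_mul] at hlt
  simp only [inner_sub_right, inner_add_right, inner_smul_right] at h1 h2
  linarith

theorem IsLegendre.mem_interior_dom_conj (hH : IsLegendre H) (h : v ∈ subdiff H p) :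
    v ∈ interior (dom (conj H)) :=
  (hH.gammaZero.hasGrowth_of_unique h fun _ hq => hH.eq_of_mem_subdiff h hq).mem_interior
    hH.gammaZero.ne_bot

theorem IsLegendre.hasGradientAt_conj (hH : IsLegendre H) (h : v ∈ subdiff H p) :
    HasGradientAt (fun w => (conj H w).toReal) p v :=
  ConvexModel.hasGradientAt_conj hH.gammaZero.ne_bot hH.gammaZero.proper hH.gammaZero.lsc
    (hH.mem_interior_dom_conj h) h fun _ hq => hH.eq_of_mem_subdiff h hq

theorem IsLegendre.exists_mem_subdiff (hH : IsLegendre H) (h : v ∈ interior (dom (conj H))) :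
    ∃ q, v ∈ subdiff H q :=
  (hasGrowth_of_mem_interior hH.gammaZero.ne_bot h).exists_mem_subdiff
    hH.gammaZero.ne_bot hH.gammaZero.proper hH.gammaZero.lsc

end Legendre

/-! ### Fenchel duality -/

section Duality
variable {n : ℕ} {J H : ExtFun n} {p x : EuclideanSpace ℝ (Fin n)} {t : ℝ}

/-- The dual problem `min_p J*(p) + t H(p) - ⟨p, x⟩` has a solution `p` when
`x ∈ dom J + t int dom H*`. -/
theorem exists_dual_minimizer (hJb : ∀ y, J y ≠ ⊥) (hJfin : ∀ q, ∃ r : ℝ, conj J q = r)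
    (hHb : ∀ y, H y ≠ ⊥) (hHp : (dom H).Nonempty) (hHl : LowerSemicontinuous H)
    (ht : 0 < t) (hx : x ∈ dom J + t • interior (dom (conj H))) :
    ∃ (p : EuclideanSpace ℝ (Fin n)) (r s : ℝ), conj J p = r ∧ H p = s ∧
      ∀ (q : EuclideanSpace ℝ (Fin n)) (r' s' : ℝ), conj J q ≤ r' → H q ≤ s' →
        r + t * s - inner ℝ x p ≤ r' + t * s' - inner ℝ x q := by
  obtain ⟨x₀, hx₀, _, ⟨v₀, hv₀, rfl⟩, rfl⟩ := hx
  obtain ⟨j, hj⟩ := exists_real_of_mem_dom hJb hx₀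
  obtain ⟨ε, hε, C, hC⟩ := hasGrowth_of_mem_interior hHb hv₀
  obtain ⟨q₀, hq₀⟩ := hHp
  obtain ⟨s₀, hs₀⟩ := exists_real_of_mem_dom hHb hq₀
  obtain ⟨r₀, hr₀⟩ := hJfin q₀
  set x := x₀ + t • v₀ with hxdef
  have hlowJ : ∀ (q : EuclideanSpace ℝ (Fin n)) (r : ℝ), conj J q ≤ r →
      inner ℝ x₀ q - j ≤ r := fun q r hr => by
    have := (conj_le_iff hJb).1 hr x₀ j hj.le
    rwa [real_inner_comm] at this
  have hinner : ∀ q, inner ℝ x q = inner ℝ x₀ q + t * inner ℝ v₀ q := fun q => by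
    rw [hxdef, inner_add_left, real_inner_smul_left]
  have hclosed : IsClosed {z : EuclideanSpace ℝ (Fin n) × ℝ × ℝ |
      conj J z.1 ≤ z.2.1 ∧ H z.1 ≤ z.2.2} :=
    ((isClosed_epigraph_conj hJb).preimage
      (continuous_fst.prodMk (continuous_fst.comp continuous_snd))).inter
    ((isClosed_epigraph hHl).preimage
      (continuous_fst.prodMk (continuous_snd.comp continuous_snd)))
  obtain ⟨⟨p, r, s⟩, ⟨hpr, hps⟩, hmin⟩ := exists_isMinOn_of_isBounded_sublevel hclosed
    (g := fun z => z.2.1 + t * z.2.2 - inner ℝ x z.1) (by fun_prop) (k := (q₀, r₀, s₀))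
    ⟨hr₀.le, hs₀.le⟩ (by
      set c := r₀ + t * s₀ - inner ℝ x q₀
      set R := (c + j + t * C) / (t * ε)
      set A := |c| + ‖x‖ * |R| + |j| + ‖x₀‖ * |R| + t * |C| + t * (‖v₀‖ * |R|)
      refine (Metric.isBounded_closedBall (x := (0 : EuclideanSpace ℝ (Fin n) × ℝ × ℝ))
        (r := |R| + A + A / t)).subset ?_
      rintro ⟨q, r, s⟩ ⟨⟨h1, h2⟩, h3⟩
      simp only at h1 h2
      change r + t * s - inner ℝ x q ≤ c at h3
      have h4 := hlowJ q r h1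
      have h5 := hC q s h2
      have h6 : t * (inner ℝ v₀ q + ε * ‖q‖ - C) ≤ t * s := by gcongr
      have h7 := hinner q
      have hR : ‖q‖ ≤ R := by
        rw [le_div_iff₀ (by positivity)]
        linarith
      have hR' := hR.trans (le_abs_self R)
      have hb : ∀ y : EuclideanSpace ℝ (Fin n), |inner ℝ y q| ≤ ‖y‖ * |R| := fun y =>
        (abs_real_inner_le_norm y q).trans (by gcongr)
      have hbx := abs_le.1 (hb x)
      have hb0 := abs_le.1 (hb x₀)
      have hbv := abs_le.1 (hb v₀)
      have hbv' : t * -(‖v₀‖ * |R|) ≤ t * inner ℝ v₀ q := by gcongr; exact hbv.1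
      have e1 := le_abs_self c
      have e2 := abs_nonneg c
      have e3 := le_abs_self j
      have e4 := abs_nonneg j
      have e5 : t * C ≤ t * |C| := by gcongr; exact le_abs_self C
      have e6 : 0 ≤ t * |C| := by positivity
      have e7 : 0 ≤ ‖x‖ * |R| := by positivity
      have e8 : 0 ≤ ‖x₀‖ * |R| := by positivity
      have e9 : 0 ≤ t * (‖v₀‖ * |R|) := by positivity
      have e10 : 0 ≤ t * (ε * ‖q‖) := by positivity
      have hA : 0 ≤ A := by positivity
      have hAt : 0 ≤ A / t := by positivity
      have e11 := abs_nonneg R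
      have hr : |r| ≤ A := abs_le.2 ⟨by linarith, by linarith⟩
      have hs : |s| ≤ A / t := by
        rw [abs_le, ← neg_div, div_le_iff₀ ht, le_div_iff₀ ht]
        exact ⟨by linarith, by linarith⟩
      rw [mem_closedBall_zero_iff, Prod.norm_def, max_le_iff, Prod.norm_def, max_le_iff,
        Real.norm_eq_abs, Real.norm_eq_abs]
      exact ⟨by linarith, by linarith, by linarith⟩)
  obtain ⟨r₁, hr₁⟩ := hJfin p
  obtain ⟨s₁, hs₁, hss⟩ := exists_real_of_le hHb hps
  have hrr : r₁ ≤ r := by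
    have : conj J p ≤ r := hpr
    rw [hr₁] at this
    exact_mod_cast this
  refine ⟨p, r₁, s₁, hr₁, hs₁, fun q r' s' h1 h2 => ?_⟩
  have h3 := hmin (q, r', s') ⟨h1, h2⟩
  simp only at h3
  have : t * s₁ ≤ t * s := by gcongr
  linarith

theorem IsGammaZero.convex_setOf_mem_subdiff (hJ : IsGammaZero J) :
    Convex ℝ {z | p ∈ subdiff J z} := by
  intro y hy z hz a b ha hb hab
  obtain ⟨c, hc⟩ := exists_real_of_mem_subdiff hJ.ne_bot hJ.proper hy
  obtain ⟨d, hd⟩ := exists_real_of_mem_subdiff hJ.ne_bot hJ.proper hz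
  obtain ⟨e, he, hle⟩ := exists_real_of_le hJ.ne_bot (hJ.le_combo hc.le hd.le ha hb hab)
  refine (mem_subdiff_iff hJ.ne_bot he).2 fun u r hr => ?_
  have h1 := (mem_subdiff_iff hJ.ne_bot hc).1 hy u r hr
  have h2 := (mem_subdiff_iff hJ.ne_bot hd).1 hz u r hr
  simp only [inner_sub_right, inner_add_right, inner_smul_right] at h1 h2 ⊢
  obtain rfl : a = 1 - b := by linarith
  nlinarith

theorem HasGrowth.isCompact_setOf_mem_subdiff (hg : HasGrowth J p) (hb : ∀ y, J y ≠ ⊥)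
    (hp : (dom J).Nonempty) (hl : LowerSemicontinuous J) :
    IsCompact {z | p ∈ subdiff J z} := by
  refine IsSeqCompact.isCompact fun u hu => ?_
  obtain ⟨q, hq, φ, hφ, hlim⟩ := hg.exists_tendsto_subseq hb hp hl
    (tendsto_const_nhds (x := p)) hu
  exact ⟨q, hq, φ, hφ, hlim⟩

/-- First-order optimality in the dual problem, in the direction of one point `q` of the domain of
`H`. The directional derivative of `J*` at `p` is the maximum of `⟨z, q - p⟩` over the points `z`
with `p ∈ ∂J(z)`; here `z` is obtained as a limit of such points for parameters tending to `p`
along the segment. -/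
theorem exists_subgradient_of_dual_minimizer (hJ : IsGammaZero J) (hJg : ∀ q, HasGrowth J q)
    (hH : IsGammaZero H) {r s : ℝ} (hr : conj J p = r) (hs : H p = s)
    (hmin : ∀ (q : EuclideanSpace ℝ (Fin n)) (r' s' : ℝ), conj J q ≤ r' → H q ≤ s' →
        r + t * s - inner ℝ x p ≤ r' + t * s' - inner ℝ x q)
    {q : EuclideanSpace ℝ (Fin n)} {s' : ℝ} (hq : H q ≤ s') :
    ∃ z, p ∈ subdiff J z ∧ inner ℝ (x - z) (q - p) ≤ t * (s' - s) := by
  set δ : ℕ → ℝ := fun k => 1 / ((k : ℝ) + 1)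
  have hδ : Tendsto δ atTop (𝓝 0) := tendsto_one_div_add_atTop_nhds_zero_nat
  have hδ0 : ∀ k, 0 < δ k := fun k => Nat.one_div_pos_of_nat
  have hδ1 : ∀ k, δ k ≤ 1 := fun k => by
    rw [div_le_one (by positivity)]
    linarith [(Nat.cast_nonneg k : (0 : ℝ) ≤ k)]
  set w : ℕ → EuclideanSpace ℝ (Fin n) := fun k => (1 - δ k) • p + δ k • q
  have hw : Tendsto w atTop (𝓝 p) := by
    have : Tendsto w atTop (𝓝 ((1 - (0 : ℝ)) • p + (0 : ℝ) • q)) :=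
      ((tendsto_const_nhds.sub hδ).smul_const p).add (hδ.smul_const q)
    simpa using this
  choose u hu using fun k => (hJg (w k)).exists_mem_subdiff hJ.ne_bot hJ.proper hJ.lsc
  have hine : ∀ k, inner ℝ (x - u k) (q - p) ≤ t * (s' - s) := fun k => by
    obtain ⟨a, ha⟩ := exists_real_of_mem_subdiff hJ.ne_bot hJ.proper (hu k)
    have h1 := hmin (w k) _ _ ((mem_subdiff_iff_conj_eq hJ.ne_bot ha).1 (hu k)).le
      (hH.le_combo hs.le hq (sub_nonneg.2 (hδ1 k)) (hδ0 k).le (by ring))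
    have h2 := (conj_le_iff hJ.ne_bot).1 hr.le (u k) a ha.le
    have hwk : w k = p + δ k • (q - p) := by simp only [w]; module
    rw [hwk] at h1
    simp only [inner_add_left, inner_add_right, inner_smul_right, real_inner_smul_left] at h1
    rw [inner_sub_left]
    rw [real_inner_comm (u k) (q - p)] at h1
    refine le_of_mul_le_mul_left ?_ (hδ0 k)
    linarith
  obtain ⟨z, hz, φ, -, hlim⟩ :=
    (hJg p).exists_tendsto_subseq hJ.ne_bot hJ.proper hJ.lsc hw hu
  exact ⟨z, hz, le_of_tendsto ((tendsto_const_nhds.sub hlim).inner tendsto_const_nhds)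
    (Eventually.of_forall fun k => hine (φ k))⟩

/-- A primal-dual solution. Sion's minimax theorem, on the product of the compact convex set
`{z | p ∈ ∂J(z)}` with the epigraph of `H`, turns the directional optimality conditions into a
single `z` that works in all directions. -/
theorem exists_primal_dual (hJ : IsGammaZero J) (hJg : ∀ q, HasGrowth J q)
    (hH : IsGammaZero H) (ht : 0 < t) (hx : x ∈ dom J + t • interior (dom (conj H))) :
    ∃ p v, p ∈ subdiff J (x - t • v) ∧ v ∈ subdiff H p := by
  have hJfin : ∀ q, ∃ r : ℝ, conj J q = r := fun q => by
    obtain ⟨z, hz⟩ := (hJg q).exists_mem_subdiff hJ.ne_bot hJ.proper hJ.lsc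
    obtain ⟨a, ha⟩ := exists_real_of_mem_subdiff hJ.ne_bot hJ.proper hz
    exact ⟨_, (mem_subdiff_iff_conj_eq hJ.ne_bot ha).1 hz⟩
  obtain ⟨p, r, s, hr, hs, hmin⟩ :=
    exists_dual_minimizer hJ.ne_bot hJfin hH.ne_bot hH.proper hH.lsc ht hx
  set M := {z | p ∈ subdiff J z}
  have hMc : IsCompact M := (hJg p).isCompact_setOf_mem_subdiff hJ.ne_bot hJ.proper hJ.lsc
  set Y := {y : EuclideanSpace ℝ (Fin n) × ℝ | H y.1 ≤ y.2}
  have hY : Convex ℝ Y := fun y hy z hz a b ha hb hab => hH.le_combo hy hz ha hb hab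
  let φ : EuclideanSpace ℝ (Fin n) → EuclideanSpace ℝ (Fin n) × ℝ → ℝ :=
    fun z y => inner ℝ (x - z) (y.1 - p) - t * (y.2 - s)
  have hφ : Continuous fun a : EuclideanSpace ℝ (Fin n) × (EuclideanSpace ℝ (Fin n) × ℝ) =>
      φ a.1 a.2 := by fun_prop
  suffices h : ∃ z ∈ M, ∀ y ∈ Y, φ z y ≤ 0 by
    obtain ⟨z, hz, hzy⟩ := h
    have hxz : x - t • (t⁻¹ • (x - z)) = z := by rw [smul_inv_smul₀ ht.ne']; abel
    refine ⟨p, t⁻¹ • (x - z), by rwa [hxz], (mem_subdiff_iff hH.ne_bot hs).2 fun q s' hq => ?_⟩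
    have h1 : inner ℝ (x - z) (q - p) - t * (s' - s) ≤ 0 := hzy (q, s') hq
    rw [real_inner_smul_left]
    have h2 : t⁻¹ * inner ℝ (x - z) (q - p) ≤ s' - s := by
      rw [inv_mul_le_iff₀ ht]; linarith
    linarith
  by_contra! hcon
  obtain ⟨T, hTY, hTf, hT⟩ : ∃ T ⊆ Y, T.Finite ∧ ∀ z ∈ M, ∃ y ∈ T, 0 < φ z y := by
    obtain ⟨T, hTY, hTf, hT⟩ := hMc.elim_finite_subcover_image (b := Y)
      (c := fun y => {z | 0 < φ z y})
      (fun y _ => isOpen_lt continuous_const (hφ.comp (by fun_prop : Continuous fun z => (z, y))))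
      (fun z hz => by simpa using hcon z hz)
    exact ⟨T, hTY, hTf, fun z hz => by simpa using hT hz⟩
  have hMne : M.Nonempty := (hJg p).exists_mem_subdiff hJ.ne_bot hJ.proper hJ.lsc
  obtain ⟨⟨q, s'⟩, hy, hpos⟩ := Sion.exists_lt_iInf_of_lt_iInf_of_finite hMne hMc (f := φ)
    (fun y _ => (hφ.comp (by fun_prop : Continuous fun z => (z, y))).lowerSemicontinuous
      |>.lowerSemicontinuousOn M)
    (fun y _ => ConvexOn.quasiconvexOn ⟨hJ.convex_setOf_mem_subdiff, fun z _ z' _ a b _ _ hab => by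
      obtain rfl : a = 1 - b := by linarith
      simp only [φ, inner_sub_left, inner_add_left, real_inner_smul_left, smul_eq_mul]
      apply le_of_eq
      ring⟩)
    hY
    (fun z _ => (hφ.comp (by fun_prop : Continuous fun y => (z, y))).upperSemicontinuous
      |>.upperSemicontinuousOn Y)
    (fun z _ => ConcaveOn.quasiconcaveOn ⟨hY, fun y _ y' _ a b _ _ hab => by
      obtain rfl : a = 1 - b := by linarith
      simp only [φ, inner_sub_right, inner_add_right, inner_smul_right, smul_eq_mul,
        Prod.fst_add, Prod.snd_add, Prod.smul_fst, Prod.smul_snd]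
      apply le_of_eq
      ring⟩)
    hJ.convex_setOf_mem_subdiff hTf hTY (t := 0) hT
  obtain ⟨z, hz, hle⟩ := exists_subgradient_of_dual_minimizer hJ hJg hH hr hs hmin hy
  have h1 : 0 < inner ℝ (x - z) (q - p) - t * (s' - s) := hpos z hz
  linarith

theorem conj_const_mul (hb : ∀ y, H y ≠ ⊥) (ht : 0 < t) {g : ℝ} (hg : conj H (t⁻¹ • x) = g) :
    conj (fun p => (t : EReal) * H p) x = ((t * g : ℝ) : EReal) := by
  have hb' : ∀ y, (t : EReal) * H y ≠ ⊥ := fun y => by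
    rcases eq_or_ne (H y) ⊤ with h | h
    · rw [h, EReal.coe_mul_top_of_pos ht]; exact top_ne_bot
    · rw [← EReal.coe_toReal h (hb y), ← EReal.coe_mul]; exact EReal.coe_ne_bot _
  have hle : ∀ y (r : ℝ), (t : EReal) * H y ≤ r → H y ≤ ((t⁻¹ * r : ℝ) : EReal) := fun y r hr => by
    rcases eq_or_ne (H y) ⊤ with h | h
    · rw [h, EReal.coe_mul_top_of_pos ht] at hr
      exact absurd (top_le_iff.1 hr) (EReal.coe_ne_top r)
    · rw [← EReal.coe_toReal h (hb y)] at hr ⊢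
      have h1 : t * (H y).toReal ≤ r := by exact_mod_cast hr
      exact_mod_cast (le_inv_mul_iff₀ ht).2 h1
  have key : ∀ c : ℝ, conj (fun p => (t : EReal) * H p) x ≤ c ↔ t * g ≤ c := fun c => by
    rw [conj_le_iff hb', ← le_inv_mul_iff₀ ht, ← EReal.coe_le_coe_iff, ← hg, conj_le_iff hb]
    constructor
    · intro h y r hr
      have h1 := h y (t * r) (by
        rw [EReal.coe_mul]
        exact mul_le_mul_of_nonneg_left hr (by exact_mod_cast ht.le))
      rw [real_inner_smul_left, le_inv_mul_iff₀ ht, mul_sub, mul_inv_cancel_left₀ ht.ne']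
      exact h1
    · intro h y r hr
      have h1 := h y (t⁻¹ * r) (hle y r hr)
      rwa [real_inner_smul_left, ← mul_sub, mul_le_mul_iff_right₀ (inv_pos.2 ht)] at h1
  refine le_antisymm ((key _).2 le_rfl) (EReal.le_of_forall_lt_iff_le.1 fun c hc => ?_)
  exact_mod_cast (key c).1 hc.le

end Duality

/-! ### The two objectives -/

section Values
variable {n : ℕ} {J H : ExtFun n} {p q v w x : EuclideanSpace ℝ (Fin n)} {t a b c g s : ℝ}

theorem nonadditive_eq (hb : ∀ y, H y ≠ ⊥) (ht : t ≠ 0) (hgrad : grad (conj H) w = q)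
    (hHq : H q = b) (hwq : w ∈ subdiff H q) (hg : conj H (t⁻¹ • x) = g) (hc : conj J q = c) :
    nonadditive J H t x w = ((t * (g + b) - inner ℝ q x + c : ℝ) : EReal) := by
  rw [nonadditive, bregman, hgrad, hg, hc, (mem_subdiff_iff_conj_eq hb hHq).1 hwq]
  norm_cast
  rw [inner_sub_right, inner_smul_right, real_inner_comm q w]
  field_simp
  ring

theorem le_additive (hJ : J (x - t • v) = a) (hJs : p ∈ subdiff J (x - t • v)) (hH : H p = s)
    (ht : 0 ≤ t) (w : EuclideanSpace ℝ (Fin n)) :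
    ((a + t * (inner ℝ v p - s) : ℝ) : EReal) ≤ additive J H t x w := by
  have h1 : ((a + inner ℝ p (x - t • w - (x - t • v)) : ℝ) : EReal) ≤ J (x - t • w) := by
    have := hJs (x - t • w)
    rw [hJ] at this
    exact_mod_cast this
  have h2 : ((inner ℝ w p - s : ℝ) : EReal) ≤ conj H w := coe_sub_le_conj hH
  have h3 : ((t * (inner ℝ w p - s) : ℝ) : EReal) ≤ (t : EReal) * conj H w := by
    rw [EReal.coe_mul]
    exact mul_le_mul_of_nonneg_left h2 (by exact_mod_cast ht)
  refine le_trans (le_of_eq ?_) (add_le_add h1 h3)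
  norm_cast
  rw [sub_sub_sub_cancel_left, ← smul_sub, inner_smul_right, inner_sub_right,
    real_inner_comm v p, real_inner_comm w p]
  ring

/-- A minimizer of the second problem attains equality in the Fenchel–Young inequality for `H`. -/
theorem mem_subdiff_of_additive_le (hHb : ∀ y, H y ≠ ⊥) (hJb : ∀ y, J y ≠ ⊥)
    (hHp : (dom H).Nonempty) (hJ : J (x - t • v) = a)
    (hJs : p ∈ subdiff J (x - t • v)) (hH : H p = s) (ht : 0 < t)
    (hw : additive J H t x w ≤ ((a + t * (inner ℝ v p - s) : ℝ) : EReal)) :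
    w ∈ subdiff H p := by
  have hGb : conj H w ≠ ⊥ := conj_ne_bot hHb hHp
  have hGt : conj H w ≠ ⊤ := fun h => by
    rw [additive, h, EReal.coe_mul_top_of_pos ht, EReal.add_top_of_ne_bot (hJb _)] at hw
    exact EReal.coe_ne_top _ (top_le_iff.1 hw)
  obtain ⟨e, he⟩ : ∃ e : ℝ, conj H w = e := ⟨_, (EReal.coe_toReal hGt hGb).symm⟩
  have hJt : J (x - t • w) ≠ ⊤ := fun h => by
    rw [additive, h, he, ← EReal.coe_mul, EReal.top_add_coe] at hw
    exact EReal.coe_ne_top _ (top_le_iff.1 hw)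
  obtain ⟨d, hd⟩ : ∃ d : ℝ, J (x - t • w) = d := ⟨_, (EReal.coe_toReal hJt (hJb _)).symm⟩
  rw [additive, hd, he] at hw
  have h1 : d + t * e ≤ a + t * (inner ℝ v p - s) := by exact_mod_cast hw
  have h2 := (mem_subdiff_iff hJb hJ).1 hJs _ d hd.le
  rw [sub_sub_sub_cancel_left, ← smul_sub, inner_smul_right, inner_sub_right,
    real_inner_comm v p, real_inner_comm w p] at h2
  have h3 : inner ℝ w p - s ≤ e := by exact_mod_cast he ▸ coe_sub_le_conj (v := w) hH
  refine (mem_subdiff_iff_conj_eq hHb hH).2 ?_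
  rw [he, EReal.coe_eq_coe_iff]
  refine le_antisymm (le_of_mul_le_mul_left ?_ ht) h3
  linarith

end Values

end ConvexModel

theorem proposition3p1 (n : ℕ) (J H : ConvexModel.ExtFun n)
    (hJ : ConvexModel.IsGammaZero J) (hJc : ConvexModel.IsOneCoercive J)
    (hH : ConvexModel.IsLegendre H)
    (t : ℝ) (ht : 0 < t) (x : EuclideanSpace ℝ (Fin n))
    (hx : x ∈ (ConvexModel.dom J + t • interior (ConvexModel.dom (ConvexModel.conj H))) ∩
      (t • ConvexModel.dom (ConvexModel.conj H))) :
    -- the gradient in the first model exists at every admissible point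
    (∀ v ∈ interior (ConvexModel.dom (ConvexModel.conj H)),
      ConvexModel.DiffAt (ConvexModel.conj H) v) ∧
    (∃! v, v ∈ ConvexModel.argmin (interior (ConvexModel.dom (ConvexModel.conj H)))
      (ConvexModel.nonadditive J H t x)) ∧
    (∃! v, v ∈ ConvexModel.argmin univ (ConvexModel.additive J H t x)) ∧
    ConvexModel.argmin (interior (ConvexModel.dom (ConvexModel.conj H)))
        (ConvexModel.nonadditive J H t x) =
      ConvexModel.argmin univ (ConvexModel.additive J H t x) ∧
    -- the minimal values are attained, finite, and satisfy the identity
    ∃ m₁ m₂ : ℝ,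
      IsLeast (ConvexModel.nonadditive J H t x ''
        interior (ConvexModel.dom (ConvexModel.conj H))) (m₁ : EReal) ∧
      IsLeast (range (ConvexModel.additive J H t x)) (m₂ : EReal) ∧
      ((m₁ + m₂ : ℝ) : EReal) = ConvexModel.conj (fun p => (t : EReal) * H p) x := by
  have hJb := hJ.ne_bot
  have hHb := hH.gammaZero.ne_bot
  have hHp := hH.gammaZero.proper
  have hJg := hJc.hasGrowth hJb hJ.lsc
  obtain ⟨p, v, hpJ, hvp⟩ := ConvexModel.exists_primal_dual hJ hJg hH.gammaZero ht hx.1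
  obtain ⟨a, ha⟩ := ConvexModel.exists_real_of_mem_subdiff hJb hJ.proper hpJ
  obtain ⟨s, hs⟩ := ConvexModel.exists_real_of_mem_subdiff hHb hHp hvp
  obtain ⟨g, hg⟩ := ConvexModel.exists_real_of_mem_dom
    (fun y => ConvexModel.conj_ne_bot (v := y) hHb hHp)
    ((Set.mem_smul_set_iff_inv_smul_mem₀ ht.ne' _ _).1 hx.2)
  have hvi := hH.mem_interior_dom_conj hvp
  have hGv := (ConvexModel.mem_subdiff_iff_conj_eq hHb hs).1 hvp
  set m₂ := a + t * (inner ℝ v p - s) with hm₂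
  have hadd_v : ConvexModel.additive J H t x v = m₂ := by
    rw [ConvexModel.additive, ha, hGv]
    norm_cast
  have hadd : ∀ w, (m₂ : EReal) ≤ ConvexModel.additive J H t x w :=
    ConvexModel.le_additive ha hpJ hs ht.le
  have hargadd : ConvexModel.argmin univ (ConvexModel.additive J H t x) = {v} := by
    refine Set.eq_singleton_iff_unique_mem.2 ⟨⟨mem_univ _, fun w _ => hadd_v ▸ hadd w⟩, ?_⟩
    intro w hw
    have hwp := ConvexModel.mem_subdiff_of_additive_le hHb hJb hHp ha hpJ hs ht
      (hadd_v ▸ hw.2 v (mem_univ v))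
    rw [hH.eq_grad_of_mem_subdiff hwp, hH.eq_grad_of_mem_subdiff hvp]
  have hnon_v : ConvexModel.nonadditive J H t x v = ((t * g - m₂ : ℝ) : EReal) := by
    rw [ConvexModel.nonadditive_eq hHb ht.ne' (hH.hasGradientAt_conj hvp).gradient hs hvp hg
      ((ConvexModel.mem_subdiff_iff_conj_eq hJb ha).1 hpJ), EReal.coe_eq_coe_iff, hm₂,
      inner_sub_right, inner_smul_right, real_inner_comm v p]
    ring
  -- at `w`, with `q = ∇H*(w)`, the first objective exceeds `t g - m₂` by the gaps in the
  -- Fenchel–Young inequalities of `J` at `(x - t v, q)` and of `H` at `(q, v)`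
  have hnon : ∀ w ∈ interior (ConvexModel.dom (ConvexModel.conj H)), ∃ V : ℝ,
      ConvexModel.nonadditive J H t x w = V ∧ t * g - m₂ ≤ V ∧ (V ≤ t * g - m₂ → w = v) := by
    intro w hw
    obtain ⟨q, hwq⟩ := hH.exists_mem_subdiff hw
    obtain ⟨b, hb⟩ := ConvexModel.exists_real_of_mem_subdiff hHb hHp hwq
    obtain ⟨z, hz⟩ := (hJg q).exists_mem_subdiff hJb hJ.proper hJ.lsc
    obtain ⟨d, hd⟩ := ConvexModel.exists_real_of_mem_subdiff hJb hJ.proper hz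
    have hc := (ConvexModel.mem_subdiff_iff_conj_eq hJb hd).1 hz
    have h1 := (ConvexModel.conj_le_iff hJb).1 hc.le _ a ha.le
    have h2 := (ConvexModel.conj_le_iff hHb).1 hGv.le q b hb.le
    have h2' : t * (inner ℝ v q - b) ≤ t * (inner ℝ v p - s) := by gcongr
    rw [inner_sub_right q x, inner_smul_right, real_inner_comm v q] at h1
    refine ⟨_, ConvexModel.nonadditive_eq hHb ht.ne' (hH.hasGradientAt_conj hwq).gradient hb hwq
      hg hc, by linarith, fun hV => ?_⟩
    have h3 : inner ℝ v p - s ≤ inner ℝ v q - b := le_of_mul_le_mul_left (by linarith) ht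
    have hvq : v ∈ ConvexModel.subdiff H q := by
      rw [ConvexModel.mem_subdiff_iff_conj_eq hHb hb, hGv, EReal.coe_eq_coe_iff]
      exact le_antisymm h3 h2
    rw [hH.eq_grad_of_mem_subdiff hwq, hH.eq_grad_of_mem_subdiff hvq]
  have hnon_le : ∀ w ∈ interior (ConvexModel.dom (ConvexModel.conj H)),
      ((t * g - m₂ : ℝ) : EReal) ≤ ConvexModel.nonadditive J H t x w := fun w hw => by
    obtain ⟨V, hV, hle, -⟩ := hnon w hw
    rw [hV]
    exact_mod_cast hle
  have hargnon : ConvexModel.argmin (interior (ConvexModel.dom (ConvexModel.conj H)))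
      (ConvexModel.nonadditive J H t x) = {v} := by
    refine Set.eq_singleton_iff_unique_mem.2 ⟨⟨hvi, fun w hw => hnon_v ▸ hnon_le w hw⟩, ?_⟩
    intro w hw
    obtain ⟨V, hV, -, heq⟩ := hnon w hw.1
    have hle := hw.2 v hvi
    rw [hV, hnon_v] at hle
    exact heq (by exact_mod_cast hle)
  refine ⟨fun w hw => ?_, ?_, ?_, hargnon.trans hargadd.symm, t * g - m₂, m₂,
    ⟨⟨v, hvi, hnon_v⟩, ?_⟩, ⟨⟨v, hadd_v⟩, ?_⟩, ?_⟩
  · obtain ⟨q, hwq⟩ := hH.exists_mem_subdiff hw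
    exact (hH.hasGradientAt_conj hwq).differentiableAt
  · simp only [hargnon, mem_singleton_iff, existsUnique_eq]
  · simp only [hargadd, mem_singleton_iff, existsUnique_eq]
  · rintro _ ⟨w, hw, rfl⟩
    exact hnon_le w hw
  · rintro _ ⟨w, rfl⟩
    exact hadd w
  · rw [ConvexModel.conj_const_mul hHb ht hg, sub_add_cancel]
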